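/- Let $\Sigma=\{a,b\}$. A finite word $w$ over $\Sigma$ is called Sturmian if it is balanced, that is, if for any two factors $u,v$ of $w$ of the same length, the numbers of occurrences of the letter $a$ in $u$ and in $v$ differ by at most $1$. A Sturmian word $w$ is bispecial if $aw$, $bw$, $wa$ and $wb$ are all Sturmian; a bispecial Sturmian word $w$ is strictly bispecial if $awa$, $awb$, $bwa$ and $bwb$ are all Sturmian, and non-strictly bispecial otherwise. Let $\phi$ denote Euler's totient function. For every integer $n>1$, the number of non-strictly bispecial Sturmian words of length $n$ is exactly $2\bigl(n+1-\phi(n+2)\bigr)$. -/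

import Mathlib

/-- The two-letter alphabet `Σ = {a, b}`. -/
inductive Letter where
  | a : Letter
  | b : Letter
  deriving DecidableEq

instance : Fintype Letter where
  elems := {Letter.a, Letter.b}
  complete := fun x => by cases x <;> simp

/-- Finite words over `Σ = {a, b}`. -/
abbrev Word := List Letter

namespace Word

/-- A word is balanced if the numbers of occurrences of the letter `a` in any two of its factors of
the same length differ by at most one (`u <:+: w` says that `u` is a factor of `w`, that is, a block
of consecutive letters). -/
def IsBalanced (w : Word) : Prop :=
  ∀ u v : Word, u <:+: w → v <:+: w → u.length = v.length →
    |(u.count Letter.a : ℤ) - (v.count Letter.a : ℤ)| ≤ 1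

/-- The language `St` of (finite) Sturmian words: the balanced words over `{a, b}`. -/
def St : Set Word := {w | IsBalanced w}

/-- The set `LS` of left special Sturmian words. -/
def LS : Set Word := {w | w ∈ St ∧ Letter.a :: w ∈ St ∧ Letter.b :: w ∈ St}

/-- The set `RS` of right special Sturmian words. -/
def RS : Set Word := {w | w ∈ St ∧ w ++ [Letter.a] ∈ St ∧ w ++ [Letter.b] ∈ St}

/-- The set `BS` of bispecial Sturmian words. -/
def BS : Set Word := LS ∩ RS

/-- The set `SBS` of strictly bispecial Sturmian words: the bispecial Sturmian words `w` such that
`awa`, `awb`, `bwa` and `bwb` are all Sturmian. -/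
def SBS : Set Word := {w | w ∈ BS ∧ ∀ x y : Letter, [x] ++ w ++ [y] ∈ St}

/-- The set `NBS` of non-strictly bispecial Sturmian words: the bispecial Sturmian words that are
not strictly bispecial. -/
def NBS : Set Word := BS \ SBS

/-- The number `X(n)` of words of length `n` in the language `X`. -/
noncomputable def numOfLength (X : Set Word) (n : ℕ) : ℕ :=
  (X ∩ {w | w.length = n}).ncard

/-- The set counted by `numOfLength` is always finite. -/
theorem finite_inter_length_eq (X : Set Word) (n : ℕ) :
    (X ∩ {w | w.length = n}).Finite :=
  (List.finite_length_eq Letter n).subset Set.inter_subset_right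

end Word

/-!
For a word `w` of length `n` let `h k` be the number of `b`s among its first `k` letters. Comparing
factors with prefixes, `w` is left special iff `h i + h j ≤ h (i + j + 1) ≤ h i + h j + 1`, and `w`
is right special iff its reversal is left special. If `w` is bispecial, the only factors of `x w y`
left to compare are prefixes `x u` and suffixes `v y`; hence `w` is strictly bispecial iff it is a
palindrome, and the non-strict words come in pairs `{w, w.reverse}`.

Let `N = n + 2` and `p = h n + 1`, the number of `b`s in `awb`. The deviation
`N h k - (k + 1) p` of the path of `awb` from its chord, as a function on `ZMod N`, is
superadditive, and so is that of the reversal of `w`. A superadditive function on a finite group is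
nonpositive and invariant under translation by its zeros. Nonpositivity gives
`h k ≤ (k + 1) p / N ≤ h k + 1`, and invariance shows that equality cannot occur on both sides. So
`w` or its reversal satisfies `h k = ⌊(k + 1) p / N⌋`, and this word is a palindrome iff `p` is
coprime to `N`. Each of the `n + 1 - φ(N)` other values of `p` contributes two words.
-/

section Superadditive

variable {G M : Type*}

theorem superadditive_nonpos [Add G] [Finite G] [AddCommMonoid M] [LinearOrder M]
    [AddLeftReflectLE M] {f : G → M} (hf : ∀ x y, f x + f y ≤ f (x + y)) (y : G) : f y ≤ 0 := by
  have : Nonempty G := ⟨y⟩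
  obtain ⟨x, hx⟩ := Finite.exists_max f
  exact nonpos_of_add_le_right ((hf x y).trans (hx (x + y)))

theorem superadditive_add_right_eq [AddGroup G] [Finite G] [AddCommMonoid M] [PartialOrder M]
    [IsOrderedCancelAddMonoid M] {f : G → M} (hf : ∀ x y, f x + f y ≤ f (x + y)) {y : G}
    (hy : f y = 0) (x : G) : f (x + y) = f x := by
  have := Fintype.ofFinite G
  have hle : ∀ x ∈ Finset.univ, f x ≤ f (x + y) := fun x _ => by simpa [hy] using hf x y
  have hsum : ∑ x, f x = ∑ x, f (x + y) := (Equiv.sum_comp (Equiv.addRight y) f).symm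
  exact ((Finset.sum_eq_sum_iff_of_le hle).1 hsum x (Finset.mem_univ x)).symm

/-- Each of `f` and `g` is invariant under translation by its own zeros; hence, if both had a
nonzero zero, the relation between them would force `c + c = c`. -/
theorem superadditive_ne_zero_or_ne_zero [AddGroup G] [Finite G] [AddCommMonoid M]
    [PartialOrder M] [IsOrderedCancelAddMonoid M] {f g : G → M} {c : M}
    (hf : ∀ x y, f x + f y ≤ f (x + y)) (hg : ∀ x y, g x + g y ≤ g (x + y))
    (hc : c ≠ 0) (hfg : ∀ x, x ≠ 0 → f x + g (-x) = c) :
    (∀ x, x ≠ 0 → f x ≠ 0) ∨ ∀ x, x ≠ 0 → g x ≠ 0 := by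
  by_contra! ⟨⟨y, hy0, hy⟩, z, hz0, hz⟩
  have hfz : f (-z) = c := by simpa [hz] using hfg (-z) (neg_ne_zero.2 hz0)
  have hgy : g (-y) = c := by simpa [hy] using hfg y hy0
  have hfyz : f (-z + y) = c := (superadditive_add_right_eq hf hy _).trans hfz
  have hgyz : g (-y + z) = c := (superadditive_add_right_eq hg hz _).trans hgy
  by_cases hyz : y = z
  · subst hyz
    have hf0 : f 0 = 0 := by simpa [hy] using (superadditive_add_right_eq hf hy 0).symm
    exact hc (by rw [← hfyz, neg_add_cancel, hf0])
  · have hne : -z + y ≠ 0 := fun h => hyz (neg_add_eq_zero.1 h).symm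
    have hcc := hfg _ hne
    rw [neg_add_rev, neg_neg, hfyz, hgyz] at hcc
    exact hc (add_eq_left.1 hcc)

end Superadditive

theorem coprime_iff_forall_not_dvd_mul {N p : ℕ} (hN : 0 < N) :
    N.Coprime p ↔ ∀ m, 0 < m → m < N → ¬ N ∣ m * p := by
  refine ⟨fun h m hm hmN hdvd => hmN.not_ge (Nat.le_of_dvd hm (h.dvd_of_dvd_mul_right hdvd)),
    fun h => ?_⟩
  by_contra hco
  have hgcd : 1 < N.gcd p := lt_of_le_of_ne (Nat.gcd_pos_of_pos_left p hN) (Ne.symm hco)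
  refine h (N / N.gcd p) (Nat.div_gcd_pos_of_pos_left p hN) (Nat.div_lt_self hN hgcd) ?_
  rw [Nat.div_mul_right_comm (Nat.gcd_dvd_left N p), Nat.mul_div_assoc _ (Nat.gcd_dvd_right N p)]
  exact dvd_mul_right N _

theorem div_add_div_add_one_eq_iff {N a b q : ℕ} (hN : 0 < N) (h : a + b = q * N) :
    a / N + b / N + 1 = q ↔ ¬ N ∣ a := by
  have hdiv : q = a / N + b / N + if N ≤ a % N + b % N then 1 else 0 := by
    rw [← Nat.add_div hN, h, Nat.mul_div_cancel _ hN]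
  have hcarry : N ≤ a % N + b % N ↔ ¬ N ∣ a := by
    have hmod : N ∣ a % N + b % N := by
      rw [Nat.dvd_iff_mod_eq_zero, ← Nat.add_mod, h, Nat.mul_mod_left]
    rw [Nat.dvd_iff_mod_eq_zero]
    refine ⟨fun hle ha => ?_, fun ha => Nat.le_of_dvd (by omega) hmod⟩
    have := Nat.mod_lt b hN
    omega
  rw [← hcarry]
  split_ifs at hdiv <;> omega

theorem card_filter_not_coprime_Ioo {N : ℕ} (hN : 1 < N) :
    ((Finset.Ioo 0 N).filter fun p => ¬ N.Coprime p).card + N.totient + 1 = N := by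
  have h0 : (Finset.range N).filter (fun p => ¬ N.Coprime p) =
      insert 0 ((Finset.Ioo 0 N).filter fun p => ¬ N.Coprime p) := by
    ext p
    rcases p.eq_zero_or_pos with rfl | hp
    · simp [hN.ne', hN.pos]
    · simp [hp, hp.ne']
  have h := Finset.card_filter_add_card_filter_not (s := Finset.range N) fun p => N.Coprime p
  rw [Finset.card_range, ← Nat.totient_eq_card_coprime, h0,
    Finset.card_insert_of_notMem (by simp)] at h
  omega

namespace Word

section Height

/-- The height of `w` at `k`: the number of occurrences of `b` in the prefix of length `k` of `w`.
Words are studied through this function, the graph of their lattice path. -/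
def height (w : Word) (k : ℕ) : ℕ := (w.take k).count Letter.b

@[simp] theorem height_zero (w : Word) : height w 0 = 0 := by simp [height]

@[simp] theorem height_cons_succ (x : Letter) (w : Word) (k : ℕ) :
    height (x :: w) (k + 1) = [x].count Letter.b + height w k := by
  simp [height, List.count_cons, add_comm]

theorem height_append_of_le (w v : Word) {k : ℕ} (hk : k ≤ w.length) :
    height (w ++ v) k = height w k := by
  simp [height, List.take_append_of_le_length hk]

theorem height_length (w : Word) : height w w.length = w.count Letter.b := by
  simp [height]

theorem height_append_length (w v : Word) :
    height (w ++ v) (w ++ v).length = height w w.length + v.count Letter.b := by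
  simp only [height_length, List.count_append]

theorem height_add (w : Word) (i k : ℕ) :
    height w (i + k) = height w i + ((w.drop i).take k).count Letter.b := by
  rw [height, height, List.take_add, List.count_append]

theorem height_succ (w : Word) {k : ℕ} (hk : k < w.length) :
    height w (k + 1) = height w k + [w[k]].count Letter.b := by
  rw [height, height, List.take_succ_eq_append_getElem hk, List.count_append]

theorem height_mono (w : Word) : Monotone (height w) := fun i j hij => by
  obtain ⟨k, rfl⟩ := Nat.exists_eq_add_of_le hij
  exact (Nat.le_add_right _ _).trans_eq (height_add w i k).symm

theorem height_succ_le (w : Word) (k : ℕ) : height w (k + 1) ≤ height w k + 1 := by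
  rw [height_add]
  have hcount := List.count_le_length (a := Letter.b) (l := (w.drop k).take 1)
  have hlen := List.length_take_le 1 (w.drop k)
  omega

theorem height_le (w : Word) (k : ℕ) : height w k ≤ k :=
  List.count_le_length.trans (List.length_take_le k w)

theorem height_reverse_add {w : Word} {k l : ℕ} (h : k + l = w.length) :
    height w.reverse k + height w l = height w w.length := by
  obtain rfl : l = w.length - k := by omega
  rw [height, List.take_reverse, List.count_reverse, height, height_length, add_comm,
    ← List.count_append, List.take_append_drop]

theorem height_reverse_length (w : Word) :
    height w.reverse w.length = height w w.length := by
  simpa using height_reverse_add (w := w) (Nat.add_zero _)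

theorem ext_height {v w : Word} (hl : v.length = w.length)
    (h : ∀ k ≤ w.length, height v k = height w k) : v = w := by
  refine List.ext_getElem hl fun i hv hw => ?_
  have hcount : [v[i]].count Letter.b = [w[i]].count Letter.b := by
    have hi := h i hw.le
    have hi' := h (i + 1) hw
    rw [height_succ v hv, height_succ w hw] at hi'
    omega
  generalize v[i] = x, w[i] = y at hcount
  cases x <;> cases y <;> simp_all

theorem reverse_eq_iff_height_add_height {w : Word} :
    w.reverse = w ↔
      ∀ k l, k + l = w.length → height w k + height w l = height w w.length := by
  refine ⟨fun h k l hkl => ?_, fun h => ext_height w.length_reverse fun k hk => ?_⟩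
  · rw [← height_reverse_add hkl, h]
  · have hk' : k + (w.length - k) = w.length := by omega
    have hrev := height_reverse_add hk'
    have hw := h _ _ hk'
    omega

end Height

section Balance

theorem count_a_add_count_b (w : Word) :
    w.count Letter.a + w.count Letter.b = w.length := by
  induction w with
  | nil => rfl
  | cons x w ih => cases x <;> grind

theorem isBalanced_iff_count_b {w : Word} :
    IsBalanced w ↔ ∀ u v : Word, u <:+: w → v <:+: w → u.length = v.length →
      u.count Letter.b ≤ v.count Letter.b + 1 := by
  constructor
  · intro h u v hu hv huv
    have huab := count_a_add_count_b u
    have hvab := count_a_add_count_b v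
    have := abs_le.1 (h u v hu hv huv)
    omega
  · intro h u v hu hv huv
    have huab := count_a_add_count_b u
    have hvab := count_a_add_count_b v
    have huv' := h u v hu hv huv
    have hvu' := h v u hv hu huv.symm
    rw [abs_le]
    omega

theorem exists_height_add_length_of_isInfix {u w : Word} (h : u <:+: w) :
    ∃ i, i + u.length ≤ w.length ∧
      height w (i + u.length) = height w i + u.count Letter.b := by
  obtain ⟨s, t, rfl⟩ := h
  exact ⟨s.length, by simp, by simp [height_add]⟩

theorem isBalanced_iff_height {w : Word} :
    IsBalanced w ↔ ∀ i j k, i ≤ j → j + k ≤ w.length →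
      height w (i + k) + height w j ≤ height w (j + k) + height w i + 1 ∧
        height w (j + k) + height w i ≤ height w (i + k) + height w j + 1 := by
  rw [isBalanced_iff_count_b]
  constructor
  · intro h i j k hij hj
    have hinfix (m : ℕ) : (w.drop m).take k <:+: w :=
      (List.take_prefix _ _).isInfix.trans (List.drop_suffix _ _).isInfix
    have hlen : ((w.drop i).take k).length = ((w.drop j).take k).length := by
      simp only [List.length_take, List.length_drop]
      omega
    have hle := h _ _ (hinfix i) (hinfix j) hlen
    have hge := h _ _ (hinfix j) (hinfix i) hlen.symm
    rw [height_add, height_add]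
    omega
  · intro h u v hu hv huv
    obtain ⟨i, hi, hui⟩ := exists_height_add_length_of_isInfix hu
    obtain ⟨j, hj, hvj⟩ := exists_height_add_length_of_isInfix hv
    rw [← huv] at hj hvj
    rcases le_total i j with hij | hji
    · have := (h i j u.length hij hj).1
      omega
    · have := (h j i u.length hji hi).2
      omega

theorem isBalanced_reverse {w : Word} : IsBalanced w.reverse ↔ IsBalanced w := by
  have key : ∀ {w : Word}, IsBalanced w → IsBalanced w.reverse := fun {w} h u v hu hv huv => by
    have := h u.reverse v.reverse (by simpa using List.reverse_infix.2 hu)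
      (by simpa using List.reverse_infix.2 hv) (by simpa using huv)
    simpa only [List.count_reverse] using this
  exact ⟨fun h => by simpa using key h, key⟩

/-- Only the factors of `x :: w` that are prefixes have to be compared with factors of `w`. -/
theorem isBalanced_cons_iff {x : Letter} {w : Word} :
    IsBalanced (x :: w) ↔ IsBalanced w ∧ ∀ i j, i + j < w.length →
      [x].count Letter.b + height w i + height w j ≤ height w (i + j + 1) + 1 ∧
        height w (i + j + 1) ≤ [x].count Letter.b + height w i + height w j + 1 := by
  simp only [isBalanced_iff_height, List.length_cons]
  constructor
  · refine fun h => ⟨fun i j k hij hj => ?_, fun i j hij => ?_⟩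
    · have := h (i + 1) (j + 1) k (by omega) (by omega)
      simp only [Nat.add_right_comm _ 1 k, height_cons_succ] at this
      omega
    · have := h 0 (j + 1) (i + 1) (by omega) (by omega)
      rw [show j + 1 + (i + 1) = i + j + 1 + 1 by omega, Nat.zero_add, height_zero,
        height_cons_succ, height_cons_succ, height_cons_succ] at this
      omega
  · rintro ⟨hw, hx⟩ i (_ | j) k hij hj
    · obtain rfl : i = 0 := by omega
      simp
    rcases i with _ | i
    · rcases k with _ | k
      · simp
      have := hx k j (by omega)
      rw [show j + 1 + (k + 1) = k + j + 1 + 1 by omega, Nat.zero_add, height_zero,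
        height_cons_succ, height_cons_succ, height_cons_succ]
      omega
    · have := hw i j k (by omega) (by omega)
      simp only [Nat.add_right_comm _ 1 k, height_cons_succ]
      omega

end Balance

section Special

theorem mem_LS_iff {w : Word} :
    w ∈ LS ↔ ∀ i j, i + j < w.length →
      height w i + height w j ≤ height w (i + j + 1) ∧
        height w (i + j + 1) ≤ height w i + height w j + 1 := by
  have ha : [Letter.a].count Letter.b = 0 := rfl
  have hb : [Letter.b].count Letter.b = 1 := rfl
  simp only [LS, St, Set.mem_ofPred_eq, isBalanced_cons_iff, ha, hb]
  constructor
  · rintro ⟨-, ⟨-, h_a⟩, -, h_b⟩ i j hij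
    have := h_a i j hij
    have := h_b i j hij
    omega
  · intro h
    -- Every factor of length `k + 1` has as many `b`s as the prefix of length `k`, or one more.
    have hw : IsBalanced w := isBalanced_iff_height.2 fun i j k hij hj => by
      rcases k with _ | k
      · simp only [Nat.add_zero]
        omega
      have hi := h i k (by omega)
      have hj' := h j k (by omega)
      rw [← Nat.add_assoc, ← Nat.add_assoc]
      omega
    refine ⟨hw, ⟨hw, fun i j hij => ?_⟩, hw, fun i j hij => ?_⟩ <;>
    · have := h i j hij
      omega

theorem mem_RS_iff_reverse_mem_LS {w : Word} : w ∈ RS ↔ w.reverse ∈ LS := by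
  have hconcat (x : Letter) : IsBalanced (x :: w.reverse) ↔ IsBalanced (w ++ [x]) := by
    rw [← isBalanced_reverse]
    simp
  simp only [RS, LS, St, Set.mem_ofPred_eq, isBalanced_reverse, hconcat]

theorem mem_RS_iff {w : Word} :
    w ∈ RS ↔ ∀ i j k, i ≤ w.length → j ≤ w.length → i + j = w.length + 1 + k →
      height w w.length + height w k ≤ height w i + height w j ∧
        height w i + height w j ≤ height w w.length + height w k + 1 := by
  rw [mem_RS_iff_reverse_mem_LS, mem_LS_iff, List.length_reverse]
  constructor
  · intro h i j k hi hj hijk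
    have := h (w.length - i) (w.length - j) (by omega)
    have := height_reverse_add (w := w) (k := w.length - i) (l := i) (by omega)
    have := height_reverse_add (w := w) (k := w.length - j) (l := j) (by omega)
    have := height_reverse_add (w := w) (k := w.length - i + (w.length - j) + 1) (l := k)
      (by omega)
    omega
  · intro h i j hij
    have := h (w.length - i) (w.length - j) (w.length - (i + j + 1)) (by omega) (by omega)
      (by omega)
    have := height_reverse_add (w := w) (k := i) (l := w.length - i) (by omega)
    have := height_reverse_add (w := w) (k := j) (l := w.length - j) (by omega)
    have := height_reverse_add (w := w) (k := i + j + 1) (l := w.length - (i + j + 1)) (by omega)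
    omega

theorem reverse_mem_BS {w : Word} : w.reverse ∈ BS ↔ w ∈ BS := by
  simp only [BS, Set.mem_inter_iff, mem_RS_iff_reverse_mem_LS, List.reverse_reverse, and_comm]

theorem height_add_height_of_mem_LS {w : Word} (hw : w ∈ LS) {k l : ℕ} (h : k + l = w.length) :
    height w k + height w l ≤ height w w.length + 1 ∧
      height w w.length ≤ height w k + height w l + 1 := by
  rcases l with _ | l
  · obtain rfl : k = w.length := by omega
    rw [height_zero]
    omega
  · have hLS := mem_LS_iff.1 hw k l (by omega)
    have hmono := height_mono w (Nat.le_add_right l 1)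
    have hsucc := height_succ_le w l
    rw [show k + l + 1 = w.length by omega] at hLS
    omega

theorem cons_concat_mem_St_iff {w : Word} (hw : w ∈ BS) (x y : Letter) :
    [x] ++ w ++ [y] ∈ St ↔ ∀ k l, k + l = w.length →
      [x].count Letter.b + height w k + height w l ≤
          height w w.length + [y].count Letter.b + 1 ∧
        height w w.length + [y].count Letter.b ≤
          [x].count Letter.b + height w k + height w l + 1 := by
  obtain ⟨⟨-, hla, hlb⟩, -, hra, hrb⟩ := hw
  have hx : IsBalanced (x :: w) := by cases x <;> assumption
  have hy : IsBalanced (w ++ [y]) := by cases y <;> assumption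
  have hlen : (w ++ [y]).length = w.length + 1 := by simp
  have hend := height_append_length w [y]
  rw [hlen] at hend
  change IsBalanced (x :: (w ++ [y])) ↔ _
  rw [isBalanced_cons_iff, hlen, and_iff_right hy]
  constructor
  · intro h k l hkl
    have := h k l (by omega)
    rwa [hkl, hend, height_append_of_le w _ (by omega), height_append_of_le w _ (by omega)]
      at this
  · intro h i j hij
    rw [height_append_of_le w _ (by omega), height_append_of_le w _ (by omega)]
    rcases (Nat.lt_succ_iff.1 hij).lt_or_eq with hlt | heq
    · rw [height_append_of_le w _ (by omega)]
      exact (isBalanced_cons_iff.1 hx).2 i j hlt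
    · rw [heq, hend]
      exact h i j heq

theorem mem_SBS_iff_reverse_eq {w : Word} (hw : w ∈ BS) : w ∈ SBS ↔ w.reverse = w := by
  have ha : [Letter.a].count Letter.b = 0 := rfl
  have hb : [Letter.b].count Letter.b = 1 := rfl
  rw [reverse_eq_iff_height_add_height]
  constructor
  · rintro ⟨-, h⟩ k l hkl
    have hab := (cons_concat_mem_St_iff hw Letter.a Letter.b).1 (h _ _) k l hkl
    have hba := (cons_concat_mem_St_iff hw Letter.b Letter.a).1 (h _ _) k l hkl
    omega
  · refine fun h => ⟨hw, fun x y => (cons_concat_mem_St_iff hw x y).2 fun k l hkl => ?_⟩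
    have := h k l hkl
    cases x <;> cases y <;> omega

theorem mem_NBS_iff {w : Word} : w ∈ NBS ↔ w ∈ BS ∧ w.reverse ≠ w :=
  and_congr_right fun hw => (mem_SBS_iff_reverse_eq hw).not

theorem reverse_mem_NBS {w : Word} : w.reverse ∈ NBS ↔ w ∈ NBS := by
  rw [mem_NBS_iff, mem_NBS_iff, reverse_mem_BS, List.reverse_reverse, ne_comm]

end Special

section Christoffel

/-- The word `w` of length `n` such that `awb` codes the lattice path from `(0, 0)` that stays
closest to, and weakly below, the line of slope `p / (n + 2)`: for `0 < p < n + 2`, the word `awb`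
is a power of a lower Christoffel word. The prefix of length `k` of `w` ends at height
`⌊(k + 1) p / (n + 2)⌋`. -/
def christoffelInterior (n p : ℕ) : Word :=
  (List.range n).map fun i =>
    if (i + 2) * p / (n + 2) = (i + 1) * p / (n + 2) then Letter.a else Letter.b

@[simp] theorem length_christoffelInterior (n p : ℕ) : (christoffelInterior n p).length = n := by
  simp [christoffelInterior]

variable {n p : ℕ}

theorem height_christoffelInterior (hp : p < n + 2) {k : ℕ} (hk : k ≤ n) :
    height (christoffelInterior n p) k = (k + 1) * p / (n + 2) := by
  induction k with
  | zero => simp [Nat.div_eq_of_lt hp]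
  | succ k ih =>
    have hmono : (k + 1) * p / (n + 2) ≤ (k + 2) * p / (n + 2) := by gcongr; simp
    have hstep : (k + 2) * p / (n + 2) ≤ (k + 1) * p / (n + 2) + 1 := by
      rw [← Nat.add_div_right _ (Nat.succ_pos _)]
      gcongr
      linarith
    rw [height_succ _ (by simpa using hk), ih (by omega)]
    simp only [christoffelInterior, List.getElem_map, List.getElem_range]
    rw [show k + 1 + 1 = k + 2 from rfl]
    split_ifs with h
    · simp [h]
    · rw [List.count_singleton_self]
      omega

theorem height_christoffelInterior_self (hp0 : 0 < p) (hp : p < n + 2) :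
    height (christoffelInterior n p) n + 1 = p := by
  obtain ⟨p, rfl⟩ := Nat.exists_eq_add_one.2 hp0
  rw [height_christoffelInterior hp le_rfl, Nat.add_right_cancel_iff]
  exact Nat.div_eq_of_lt_le (by linarith) (by linarith)

theorem christoffelInterior_mem_LS (hp : p < n + 2) : christoffelInterior n p ∈ LS := by
  refine mem_LS_iff.2 fun i j hij => ?_
  rw [length_christoffelInterior] at hij
  rw [height_christoffelInterior hp (by omega), height_christoffelInterior hp (by omega),
    height_christoffelInterior hp (by omega),
    show (i + j + 1 + 1) * p = (i + 1) * p + (j + 1) * p by ring]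
  exact ⟨Nat.div_add_div_le_add_div, Nat.add_div_le_div_add_div_add_one _ _ _⟩

theorem christoffelInterior_mem_RS (hp0 : 0 < p) (hp : p < n + 2) :
    christoffelInterior n p ∈ RS := by
  refine mem_RS_iff.2 fun i j k hi hj hijk => ?_
  rw [length_christoffelInterior] at *
  have hend := height_christoffelInterior_self hp0 hp
  rw [height_christoffelInterior hp hi, height_christoffelInterior hp hj,
    height_christoffelInterior hp (k := k) (by omega)]
  have hsum : (i + 1) * p + (j + 1) * p = (k + 1) * p + p * (n + 2) := by
    rw [← Nat.add_mul, show i + 1 + (j + 1) = k + 1 + (n + 2) by omega]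
    ring
  have hdiv := congrArg (· / (n + 2)) hsum
  simp only [Nat.add_mul_div_right _ _ (show 0 < n + 2 by omega)] at hdiv
  have hle := Nat.div_add_div_le_add_div (x := (i + 1) * p) (y := (j + 1) * p) (z := n + 2)
  have hge := Nat.add_div_le_div_add_div_add_one ((i + 1) * p) ((j + 1) * p) (n + 2)
  omega

theorem christoffelInterior_mem_BS (hp0 : 0 < p) (hp : p < n + 2) :
    christoffelInterior n p ∈ BS :=
  ⟨christoffelInterior_mem_LS hp, christoffelInterior_mem_RS hp0 hp⟩

theorem reverse_christoffelInterior_eq_iff (hp0 : 0 < p) (hp : p < n + 2) :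
    (christoffelInterior n p).reverse = christoffelInterior n p ↔ (n + 2).Coprime p := by
  have hend := height_christoffelInterior_self hp0 hp
  have key : ∀ k l, k + l = n →
      (height (christoffelInterior n p) k + height (christoffelInterior n p) l =
        height (christoffelInterior n p) n ↔ ¬ n + 2 ∣ (k + 1) * p) := by
    intro k l hkl
    have hsum : (k + 1) * p + (l + 1) * p = p * (n + 2) := by
      rw [← hkl]
      ring
    rw [← div_add_div_add_one_eq_iff (by omega) hsum, height_christoffelInterior hp (by omega),
      height_christoffelInterior hp (by omega)]
    omega
  rw [reverse_eq_iff_height_add_height, coprime_iff_forall_not_dvd_mul (Nat.succ_pos _),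
    length_christoffelInterior]
  constructor
  · rintro h (_ | k) hk hkn
    · omega
    · exact (key k (n - k) (by omega)).1 (h _ _ (by omega))
  · exact fun h k l hkl => (key k l hkl).2 (h (k + 1) (by omega) (by omega))

theorem christoffelInterior_mem_NBS_iff (hp0 : 0 < p) (hp : p < n + 2) :
    christoffelInterior n p ∈ NBS ↔ ¬ (n + 2).Coprime p := by
  rw [mem_NBS_iff, and_iff_right (christoffelInterior_mem_BS hp0 hp), Ne,
    reverse_christoffelInterior_eq_iff hp0 hp]

end Christoffel

section Discrepancy

/-- The scaled signed distance, at abscissa `x`, from the lattice path of `awb` to the line joining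
its endpoints, where `w` has length `n`. It is a function on `ZMod (n + 2)` because the paths of
the powers of `awb` all give the same value at congruent abscissas; `bispecial` then means
superadditive for `w` and its reversal. -/
def discrepancy (n : ℕ) (w : Word) (x : ZMod (n + 2)) : ℤ :=
  (n + 2) * height (Letter.a :: w) x.val - x.val * (height w n + 1)

variable {n : ℕ} {w : Word}

theorem discrepancy_of_val_eq_succ {x : ZMod (n + 2)} {k : ℕ} (hx : x.val = k + 1) :
    discrepancy n w x = (n + 2) * height w k - (k + 1) * (height w n + 1) := by
  simp [discrepancy, hx]

theorem exists_val_eq_succ {x : ZMod (n + 2)} (hx : x ≠ 0) : ∃ k ≤ n, x.val = k + 1 := by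
  have hpos := ZMod.val_pos.2 hx
  have hlt := ZMod.val_lt x
  exact ⟨x.val - 1, by omega, by omega⟩

theorem discrepancy_zero : discrepancy n w 0 = 0 := by simp [discrepancy]

theorem discrepancy_superadditive (hn : w.length = n) (hw : w ∈ BS) (x y : ZMod (n + 2)) :
    discrepancy n w x + discrepancy n w y ≤ discrepancy n w (x + y) := by
  rcases eq_or_ne x 0 with rfl | hx
  · simp [discrepancy_zero]
  rcases eq_or_ne y 0 with rfl | hy
  · simp [discrepancy_zero]
  obtain ⟨i, hi, hxi⟩ := exists_val_eq_succ hx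
  obtain ⟨j, hj, hyj⟩ := exists_val_eq_succ hy
  rw [discrepancy_of_val_eq_succ hxi, discrepancy_of_val_eq_succ hyj]
  rcases lt_trichotomy (i + j) n with hlt | heq | hgt
  · have hval : (x + y).val = i + j + 1 + 1 := by
      rw [ZMod.val_add_of_lt (by omega)]
      omega
    have hLS : (height w i + height w j : ℤ) ≤ height w (i + j + 1) := mod_cast
      (mem_LS_iff.1 hw.1 i j (by omega)).1
    rw [discrepancy_of_val_eq_succ hval]
    push_cast
    nlinarith
  · have hval : (x + y).val = 0 := by
      have := ZMod.val_add_val_of_le (a := x) (b := y) (by omega)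
      omega
    have hend : (height w i + height w j : ℤ) ≤ height w n + 1 := mod_cast
      hn ▸ (height_add_height_of_mem_LS hw.1 (heq.trans hn.symm)).1
    rw [(ZMod.val_eq_zero _).1 hval, discrepancy_zero, ← heq]
    rw [← heq] at hend
    push_cast
    nlinarith
  · obtain ⟨k, hk⟩ := Nat.exists_eq_add_of_lt hgt
    have hval : (x + y).val = k + 1 := by
      have := ZMod.val_add_val_of_le (a := x) (b := y) (by omega)
      omega
    have hRS : (height w i + height w j : ℤ) ≤ height w n + height w k + 1 := mod_cast
      hn ▸ (mem_RS_iff.1 hw.2 i j k (by omega) (by omega) (by omega)).2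
    rw [discrepancy_of_val_eq_succ hval]
    nlinarith

theorem discrepancy_add_discrepancy_reverse_neg (hn : w.length = n) {x : ZMod (n + 2)}
    (hx : x ≠ 0) : discrepancy n w x + discrepancy n w.reverse (-x) = -(n + 2) := by
  obtain ⟨k, hk, hxk⟩ := exists_val_eq_succ hx
  obtain ⟨l, rfl⟩ := Nat.exists_eq_add_of_le hk
  have hval : (-x).val = l + 1 := by
    rw [ZMod.neg_val, if_neg hx]
    omega
  have hend : height w.reverse (k + l) = height w (k + l) := hn ▸ height_reverse_length w
  have hrev : (height w.reverse l + height w k : ℤ) = height w (k + l) := by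
    rw [← hn]
    exact_mod_cast height_reverse_add (by omega)
  rw [discrepancy_of_val_eq_succ hxk, discrepancy_of_val_eq_succ hval, hend, ← hrev]
  push_cast
  ring

theorem eq_christoffelInterior (hn : w.length = n) (hw : w ∈ BS)
    (h : ∀ x, x ≠ 0 → discrepancy n w.reverse x ≠ 0) :
    w = christoffelInterior n (height w n + 1) := by
  have hp : height w n + 1 < n + 2 := by linarith [height_le w n]
  refine ext_height (by simpa) fun k hk => ?_
  rw [length_christoffelInterior] at hk
  set x : ZMod (n + 2) := ((k + 1 : ℕ) : ZMod (n + 2))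
  have hval : x.val = k + 1 := ZMod.val_natCast_of_lt (by omega)
  have hx0 : x ≠ 0 := by
    rw [← ZMod.val_ne_zero]
    omega
  have hle := superadditive_nonpos (discrepancy_superadditive hn hw) x
  have hrev : discrepancy n w.reverse (-x) < 0 :=
    (superadditive_nonpos (discrepancy_superadditive (by simpa) (reverse_mem_BS.2 hw)) _).lt_of_ne
      (h _ (neg_ne_zero.2 hx0))
  have hsum := discrepancy_add_discrepancy_reverse_neg hn hx0
  rw [discrepancy_of_val_eq_succ hval] at hle hsum
  rw [height_christoffelInterior hp hk, eq_comm]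
  refine Nat.div_eq_of_lt_le ?_ ?_ <;> zify <;> linarith

/-- The zeros of the discrepancies of `w` and of its reversal are the lattice points where the path
touches the lower, respectively the upper, of the two parallel lines enclosing it. -/
theorem eq_christoffelInterior_or_reverse_eq (hn : w.length = n) (hw : w ∈ BS) :
    w = christoffelInterior n (height w n + 1) ∨
      w.reverse = christoffelInterior n (height w.reverse n + 1) := by
  have hn' : w.reverse.length = n := by simpa
  have hw' : w.reverse ∈ BS := reverse_mem_BS.2 hw
  have hne : (-(n + 2) : ℤ) ≠ 0 := by omega
  rcases superadditive_ne_zero_or_ne_zero (discrepancy_superadditive hn hw)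
    (discrepancy_superadditive hn' hw') hne
    (fun _ => discrepancy_add_discrepancy_reverse_neg hn) with h | h
  · exact Or.inr (eq_christoffelInterior hn' hw' (by simpa using h))
  · exact Or.inl (eq_christoffelInterior hn hw h)

end Discrepancy

section Counting

variable {n : ℕ} {w : Word}

/-- The words `w` of length `n` such that `awb` is a proper power of a lower Christoffel word. They
are half of the non-strictly bispecial words of length `n`, the other half being their reversals. -/
def imprimitiveInteriors (n : ℕ) : Set Word :=
  christoffelInterior n '' ((Finset.Ioo 0 (n + 2)).filter fun p => ¬ (n + 2).Coprime p)

theorem christoffelInterior_injOn (n : ℕ) :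
    Set.InjOn (christoffelInterior n) (Finset.Ioo 0 (n + 2)) := by
  intro p hp q hq h
  rw [Finset.mem_coe, Finset.mem_Ioo] at hp hq
  rw [← height_christoffelInterior_self hp.1 hp.2, h, height_christoffelInterior_self hq.1 hq.2]

theorem finite_imprimitiveInteriors (n : ℕ) : (imprimitiveInteriors n).Finite :=
  (Finset.finite_toSet _).image _

theorem ncard_imprimitiveInteriors_add_totient (n : ℕ) :
    (imprimitiveInteriors n).ncard + (n + 2).totient = n + 1 := by
  have hinj := (christoffelInterior_injOn n).mono (Finset.coe_subset.2
    (Finset.filter_subset (fun p => ¬ (n + 2).Coprime p) (Finset.Ioo 0 (n + 2))))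
  have hcard := card_filter_not_coprime_Ioo (N := n + 2) (by omega)
  rw [imprimitiveInteriors, hinj.ncard_image, Set.ncard_coe_finset]
  omega

theorem mem_imprimitiveInteriors_iff :
    w ∈ imprimitiveInteriors n ↔ w ∈ NBS ∧ w = christoffelInterior n (height w n + 1) := by
  simp only [imprimitiveInteriors, Set.mem_image, Finset.mem_coe, Finset.mem_filter,
    Finset.mem_Ioo]
  constructor
  · rintro ⟨p, ⟨⟨hp0, hp⟩, hco⟩, rfl⟩
    rw [height_christoffelInterior_self hp0 hp]
    exact ⟨(christoffelInterior_mem_NBS_iff hp0 hp).2 hco, rfl⟩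
  · rintro ⟨hw, heq⟩
    have hp : height w n + 1 < n + 2 := by linarith [height_le w n]
    rw [heq] at hw
    exact ⟨_, ⟨⟨Nat.succ_pos _, hp⟩, (christoffelInterior_mem_NBS_iff (Nat.succ_pos _) hp).1 hw⟩,
      heq.symm⟩

theorem length_of_mem_imprimitiveInteriors (hw : w ∈ imprimitiveInteriors n) : w.length = n := by
  rw [(mem_imprimitiveInteriors_iff.1 hw).2, length_christoffelInterior]

theorem NBS_inter_length_eq (n : ℕ) :
    NBS ∩ {w | w.length = n} = imprimitiveInteriors n ∪ List.reverse '' imprimitiveInteriors n := by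
  ext w
  constructor
  · rintro ⟨hw, hn⟩
    rcases eq_christoffelInterior_or_reverse_eq hn (mem_NBS_iff.1 hw).1 with h | h
    · exact Or.inl (mem_imprimitiveInteriors_iff.2 ⟨hw, h⟩)
    · exact Or.inr ⟨w.reverse, mem_imprimitiveInteriors_iff.2 ⟨reverse_mem_NBS.2 hw, h⟩,
        w.reverse_reverse⟩
  · rintro (hw | ⟨v, hv, rfl⟩)
    · exact ⟨(mem_imprimitiveInteriors_iff.1 hw).1, length_of_mem_imprimitiveInteriors hw⟩
    · exact ⟨reverse_mem_NBS.2 (mem_imprimitiveInteriors_iff.1 hv).1,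
        v.length_reverse.trans (length_of_mem_imprimitiveInteriors hv)⟩

theorem disjoint_imprimitiveInteriors_reverse (n : ℕ) :
    Disjoint (imprimitiveInteriors n) (List.reverse '' imprimitiveInteriors n) := by
  rw [Set.disjoint_right]
  rintro _ ⟨w, hw, rfl⟩ hrev
  obtain ⟨hNBS, heq⟩ := mem_imprimitiveInteriors_iff.1 hw
  have hend : height w.reverse n = height w n :=
    length_of_mem_imprimitiveInteriors hw ▸ height_reverse_length w
  refine (mem_NBS_iff.1 hNBS).2 ?_
  rw [(mem_imprimitiveInteriors_iff.1 hrev).2, hend, ← heq]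

end Counting

end Word

theorem mainTheorem3 (n : ℕ) (hn : 1 < n) :
    (Word.numOfLength Word.NBS n : ℤ) =
      2 * ((n : ℤ) + 1 - (Nat.totient (n + 2) : ℤ)) := by
  have hcard := Word.ncard_imprimitiveInteriors_add_totient n
  have hfin := Word.finite_imprimitiveInteriors n
  rw [Word.numOfLength, Word.NBS_inter_length_eq,
    Set.ncard_union_eq (Word.disjoint_imprimitiveInteriors_reverse n) hfin (hfin.image _),
    Set.ncard_image_of_injective _ List.reverse_injective]
  push_cast
  omega
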